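/- Let $r\in(0,1/2]$. There is a constant $\delta=\delta(r)>0$, depending only on $r$, such that the following holds. Let $A>0$ be real, let $m\ge 1$, and let $c_1,\dots,c_m$ be positive integers with $A\le c_i\le 2A$ for every $i$. Let $X_1,\dots,X_m$ be independent random variables with $\Pr[X_i=c_i]=\Pr[X_i=-c_i]=r$ and $\Pr[X_i=0]=1-2r$, and let $Y_1,\dots,Y_m$ be independent random variables such that $Y_i$ has the same distribution as $X_i$ for every $i$. Put $X=\sum_{i=1}^m X_i$ and $Y=\sum_{i=1}^m Y_i$. Then for every real $d>0$ there is a coupling of $X$ and $Y$ (a joint law whose marginals are the laws of $X$ and of $Y$) such that, if $r<1/2$, \[\Pr[d\le X-Y\le d+2A]\ \ge\ 1-\frac{\delta\,(d+A)}{A\sqrt m},\] and, if $r=1/2$ (the walk that never stands still), the same lower bound holds for $\Pr[d\le X-Y\le d+4A]$. -/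

import Mathlib

open MeasureTheory ProbabilityTheory

/-- The law on `ℤ` of a lazy symmetric step of size `c`: the values `c` and `-c` have
probability `r` each, and the value `0` has the remaining probability `1 - 2 * r`.
It is meant for `0 ≤ r ≤ 1 / 2` and `c ≠ 0`. -/
noncomputable def lazyStepLaw (r : ℝ) (c : ℤ) : Measure ℤ :=
  ENNReal.ofReal r • Measure.dirac c + ENNReal.ofReal r • Measure.dirac (-c)
    + ENNReal.ofReal (1 - 2 * r) • Measure.dirac 0

/-- `γ` is a coupling of the random variables `X` (on the space with law `P`) and `Y` (on the space
with law `Q`): a joint law whose two marginals are the laws of `X` and of `Y`. -/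
def IsCouplingOf {Ω Ω' E F : Type*} [MeasurableSpace Ω] [MeasurableSpace Ω']
    [MeasurableSpace E] [MeasurableSpace F] (γ : Measure (E × F))
    (X : Ω → E) (P : Measure Ω) (Y : Ω' → F) (Q : Measure Ω') : Prop :=
  γ.map Prod.fst = P.map X ∧ γ.map Prod.snd = Q.map Y

/-!
Run the two walks with coupled steps until their gap `X - Y` enters the window, and let them move
together from then on. If each step coupling is invariant under swapping the two walks, the change
`Z` of the gap is symmetric, so `E exp (θ Z) = E cosh (θ Z) ≥ 1 + θ² E Z² / 2`. As long as the
window has not been reached, `exp (θ gap)` therefore grows on average by these factors. Their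
product is at least `1 + θ² V / 2`, where `V` is the sum of the second moments, which is
`2` for `θ = √(2 / V)`. Optional stopping then bounds the probability of failure by
`2 θ (d + a)`, where `a` is the width of the window, provided that no step can jump over it. For
lazy steps one walk can rest whenever the gap changes, so that the gap moves by at most `c_i`; for
steps that never rest, mirrored walks have gap changes `2 c_i`, whence the wider window.
-/

theorem one_add_sq_div_two_le_cosh (x : ℝ) : 1 + x ^ 2 / 2 ≤ Real.cosh x := by
  have half_sq_le : (x / 2) ^ 2 ≤ Real.sinh (x / 2) ^ 2 := by
    rw [sq_le_sq, Real.abs_sinh]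
    exact Real.self_le_sinh_iff.2 (abs_nonneg _)
  have cosh_eq : Real.cosh x = 1 + 2 * Real.sinh (x / 2) ^ 2 := by
    rw [← mul_div_cancel₀ x two_ne_zero, Real.cosh_two_mul, Real.cosh_sq,
      mul_div_cancel₀ x two_ne_zero]
    ring
  linarith

theorem one_sub_two_mul_le_of_exp_neg_le {x p K : ℝ} (hp : p ≤ 1) (hK : K ≤ 1 / 2)
    (h : Real.exp (-x) ≤ p + (1 - p) * K) : 1 - 2 * x ≤ p := by
  have h_exp : 1 - x ≤ Real.exp (-x) := Real.one_sub_le_exp_neg x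
  have h_mul : (1 - p) * K ≤ (1 - p) * (1 / 2) :=
    mul_le_mul_of_nonneg_left hK (sub_nonneg.2 hp)
  linarith

theorem one_sub_four_mul_div_le {s d A a t : ℝ} (hs : 0 ≤ s) (ht : 0 ≤ t) (hd : 0 ≤ d)
    (ha : a ≤ 4 * A) : 1 - 4 * s * (d + A) / t ≤ 1 - s * (d + a) / t := by
  gcongr 1 - ?_ / t
  nlinarith [mul_nonneg hs hd, mul_le_mul_of_nonneg_left ha hs]

theorem one_add_sum_le_prod_one_add {ι R : Type*} [CommRing R] [LinearOrder R]
    [IsStrictOrderedRing R] {f : ι → R} (s : Finset ι) (hf : ∀ i ∈ s, 0 ≤ f i) :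
    1 + ∑ i ∈ s, f i ≤ ∏ i ∈ s, (1 + f i) := by
  classical
  induction s using Finset.induction_on with
  | empty => simp
  | insert i s hi ih =>
    have hfi : 0 ≤ f i := hf i (Finset.mem_insert_self i s)
    have hfs : ∀ j ∈ s, 0 ≤ f j := fun j hj => hf j (Finset.mem_insert_of_mem hj)
    rw [Finset.sum_insert hi, Finset.prod_insert hi]
    nlinarith [mul_le_mul_of_nonneg_left (ih hfs) hfi, ih hfs,
      mul_nonneg hfi (Finset.sum_nonneg hfs)]

theorem one_add_sq_mul_integral_sq_le_mgf {Ω : Type*} [MeasurableSpace Ω] {P : Measure Ω}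
    [IsProbabilityMeasure P] {Z : Ω → ℝ} (hZ : IdentDistrib Z (-Z) P P) {θ : ℝ}
    (hexp : Integrable (fun ω => Real.exp (θ * Z ω)) P) :
    1 + θ ^ 2 / 2 * ∫ ω, Z ω ^ 2 ∂P ≤ mgf Z P θ := by
  have hexp_neg : Integrable (fun ω => Real.exp (-(θ * Z ω))) P := by
    have hlaw := hZ.comp (u := fun z => Real.exp (θ * z)) (by fun_prop)
    simpa only [Function.comp_def, Pi.neg_apply, mul_neg] using hlaw.integrable_iff.1 hexp
  have hcosh : Integrable (fun ω => Real.cosh (θ * Z ω)) P := by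
    simp only [Real.cosh_eq]
    exact (hexp.add hexp_neg).div_const 2
  have mgf_eq : mgf Z P θ = ∫ ω, Real.cosh (θ * Z ω) ∂P := by
    have mgf_neg_eq : ∫ ω, Real.exp (-(θ * Z ω)) ∂P = mgf Z P θ := by
      rw [mgf_congr_identDistrib hZ]
      simp [mgf]
    simp only [Real.cosh_eq]
    rw [integral_div, integral_add hexp hexp_neg, mgf_neg_eq, ← mgf, add_self_div_two]
  have key : ∫ ω, θ ^ 2 / 2 * Z ω ^ 2 ∂P ≤ ∫ ω, (Real.cosh (θ * Z ω) - 1) ∂P :=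
    integral_mono_of_nonneg (ae_of_all _ fun ω => by positivity) (hcosh.sub (integrable_const 1))
      (ae_of_all _ fun ω => by
        have := one_add_sq_div_two_le_cosh (θ * Z ω)
        dsimp only
        linarith)
  rw [integral_const_mul, integral_sub hcosh (integrable_const 1), ← mgf_eq] at key
  simp only [integral_const, probReal_univ, one_smul] at key
  linarith

section CompProdAdd

variable {M N : Type*} [AddMonoid M] [AddMonoid N] [MeasurableSpace M] [MeasurableSpace N]
  [MeasurableAdd₂ M] {π : Measure M} [IsProbabilityMeasure π] {η : Kernel M M} [IsMarkovKernel η]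

theorem map_compProd_add [MeasurableAdd₂ N] {f : M →+ N} (hf : Measurable f) {ν : Measure N}
    [IsProbabilityMeasure ν] (hη : ∀ x, (η x).map f = ν) :
    ((π ⊗ₘ η).map fun q => q.1 + q.2).map f = π.map f ∗ ν := by
  have map_eq_const : η.map f = Kernel.const M ν := by
    ext1 x
    rw [Kernel.map_apply η hf, hη x, Kernel.const_apply]
  calc ((π ⊗ₘ η).map fun q => q.1 + q.2).map f
      = (((π ⊗ₘ η).map (Prod.map id f)).map (Prod.map f id)).map fun q => q.1 + q.2 := by
        rw [Measure.map_map hf measurable_add, Measure.map_map (by fun_prop) (by fun_prop),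
          Measure.map_map (by fun_prop) (by fun_prop)]
        congr 1
        ext q
        simp
    _ = π.map f ∗ ν := by
        rw [← Measure.compProd_map hf, map_eq_const, Measure.compProd_const,
          ← Measure.map_prod_map _ _ hf measurable_id, Measure.map_id, Measure.conv]

theorem measurable_real_add_preimage {S : Set M} (hS : MeasurableSet S) :
    Measurable fun x => (η x).real ((x + ·) ⁻¹' S) :=
  (Kernel.measurable_kernel_prodMk_left (measurable_add hS)).ennreal_toReal

theorem compProd_map_add_real {S : Set M} (hS : MeasurableSet S) :
    ((π ⊗ₘ η).map fun q => q.1 + q.2).real S = ∫ x, (η x).real ((x + ·) ⁻¹' S) ∂π := by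
  rw [map_measureReal_apply measurable_add hS, Measure.real,
    Measure.compProd_apply (measurable_add hS)]
  exact (integral_toReal (Kernel.measurable_kernel_prodMk_left (measurable_add hS)).aemeasurable
    (ae_of_all _ fun x => measure_lt_top _ _)).symm

end CompProdAdd

instance measurableAdd₂_prod {M N : Type*} [Add M] [Add N] [MeasurableSpace M]
    [MeasurableSpace N] [MeasurableAdd₂ M] [MeasurableAdd₂ N] : MeasurableAdd₂ (M × N) where
  measurable_add :=
    ((measurable_fst.comp measurable_fst).add (measurable_fst.comp measurable_snd)).prodMk
      ((measurable_snd.comp measurable_fst).add (measurable_snd.comp measurable_snd))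

section Diagonal

variable {E : Type*} [MeasurableSpace E]

/-- The coupling of a law with itself in which the two components are equal. -/
noncomputable def diagonalCoupling (ν : Measure E) : Measure (E × E) :=
  ν.map fun x => (x, x)

theorem diagonalCoupling_map_fst (ν : Measure E) : (diagonalCoupling ν).map Prod.fst = ν := by
  rw [diagonalCoupling, Measure.map_map measurable_fst (by fun_prop)]
  exact Measure.map_id

theorem diagonalCoupling_map_snd (ν : Measure E) : (diagonalCoupling ν).map Prod.snd = ν := by
  rw [diagonalCoupling, Measure.map_map measurable_snd (by fun_prop)]
  exact Measure.map_id

end Diagonal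

section Coupling

variable {G : Type*} [AddCommMonoid G]

/-- The difference `φ x - φ y` of the heights of the two components of a pair, where the additive
map `φ` measures heights. -/
def gap (φ : G →+ ℝ) : G × G →+ ℝ :=
  φ.comp (AddMonoidHom.fst G G) - φ.comp (AddMonoidHom.snd G G)

/-- The pairs whose gap lies in the window `[d, d + a]` of width `a` that a coupled walk has to
reach. -/
def gapWindow (φ : G →+ ℝ) (a d : ℝ) : Set (G × G) :=
  gap φ ⁻¹' Set.Icc d (d + a)

variable {φ : G →+ ℝ} {a θ : ℝ}

theorem gap_apply (p : G × G) : gap φ p = φ p.1 - φ p.2 := rfl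

theorem gap_swap (p : G × G) : gap φ p.swap = -gap φ p :=
  (neg_sub (φ p.1) (φ p.2)).symm

theorem preimage_add_gapWindow (x : G × G) (d : ℝ) :
    (x + ·) ⁻¹' gapWindow φ a d = gapWindow φ a (d - gap φ x) := by
  ext p
  simp only [gapWindow, Set.mem_preimage, map_add, Set.mem_Icc]
  constructor <;> rintro ⟨hl, hu⟩ <;> constructor <;> linarith

variable [MeasurableSpace G]

theorem measurable_gap (hφ : Measurable φ) : Measurable (gap φ) :=
  (hφ.comp measurable_fst).sub (hφ.comp measurable_snd)

theorem measurableSet_gapWindow (hφ : Measurable φ) (d : ℝ) : MeasurableSet (gapWindow φ a d) :=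
  measurable_gap hφ measurableSet_Icc

theorem diagonalCoupling_real_gapWindow (hφ : Measurable φ) (ν : Measure G)
    [IsProbabilityMeasure ν] {d : ℝ} (hd : -a ≤ d) (hd0 : d ≤ 0) :
    (diagonalCoupling ν).real (gapWindow φ a d) = 1 := by
  have preimage_eq : (fun x => (x, x)) ⁻¹' gapWindow φ a d = Set.univ :=
    Set.eq_univ_of_forall fun x => by
      simp only [gapWindow, Set.mem_preimage, gap_apply, sub_self, Set.mem_Icc]
      exact ⟨hd0, by linarith⟩
  rw [diagonalCoupling, map_measureReal_apply (by fun_prop) (measurableSet_gapWindow hφ d),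
    preimage_eq, probReal_univ]

/-- `κ d` is a coupling of `ν` with itself that aims at a gap in the window `[d, d + a]`. If it
succeeds with probability `p`, then `exp (-θ (d + a)) ≤ p + (1 - p) K`: this is what optional
stopping gives for `exp (θ (gap - d - a))`, which is at most `1` on success, while `K` is the
discount collected by the end of a walk that has failed. The target `d` is the parameter of a kernel
so that it can be updated measurably after each step of a walk. -/
structure IsShiftCoupling (φ : G →+ ℝ) (a θ K : ℝ) (ν : Measure G)
    (κ : Kernel ℝ (G × G)) : Prop where
  map_fst : ∀ d, (κ d).map Prod.fst = ν
  map_snd : ∀ d, (κ d).map Prod.snd = ν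
  exp_le : ∀ d, -a ≤ d → Real.exp (-(θ * (d + a))) ≤
    (κ d).real (gapWindow φ a d) + (1 - (κ d).real (gapWindow φ a d)) * K

variable {K : ℝ} {μ ν : Measure G} {κ : Kernel ℝ (G × G)}

theorem IsShiftCoupling.isMarkovKernel [IsProbabilityMeasure ν]
    (hκ : IsShiftCoupling φ a θ K ν κ) : IsMarkovKernel κ := by
  refine ⟨fun d => ?_⟩
  have : IsProbabilityMeasure ((κ d).map Prod.fst) := by rwa [hκ.map_fst d]
  exact Measure.isProbabilityMeasure_of_map Prod.fst

theorem isShiftCoupling_const_diagonal (φ : G →+ ℝ) (a : ℝ) (hθ : 0 ≤ θ) (ν : Measure G) :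
    IsShiftCoupling φ a θ 1 ν (Kernel.const ℝ (diagonalCoupling ν)) where
  map_fst _ := diagonalCoupling_map_fst ν
  map_snd _ := diagonalCoupling_map_snd ν
  exp_le d hd := by
    rw [mul_one, add_sub_cancel, Real.exp_le_one_iff, neg_nonpos]
    exact mul_nonneg hθ (by linarith)

section Step

/-- Couples the first step of a walk of law `ρ` by `π` and the rest of it by `κ`, with the target
lowered by the gap gained in the first step. Once the target is nonpositive the two copies of the
walk move together. -/
noncomputable def prependStep (hφ : Measurable φ) (ρ : Measure G) (π : Measure (G × G))
    (κ : Kernel ℝ (G × G)) : Kernel ℝ (G × G) :=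
  Kernel.piecewise (measurableSet_Iic (a := 0)) (Kernel.const ℝ (diagonalCoupling ρ))
    ((Kernel.const ℝ π ⊗ₖ κ.comap (fun q => q.1 - gap φ q.2)
      (measurable_fst.sub ((measurable_gap hφ).comp measurable_snd))).map fun q => q.1 + q.2)

theorem prependStep_of_nonpos (hφ : Measurable φ) (ρ : Measure G) (π : Measure (G × G)) {d : ℝ}
    (hd : d ≤ 0) : prependStep hφ ρ π κ d = diagonalCoupling ρ := by
  rw [prependStep, Kernel.piecewise_apply, if_pos (Set.mem_Iic.2 hd), Kernel.const_apply]

variable [MeasurableAdd₂ G]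

theorem prependStep_of_pos (hφ : Measurable φ) (ρ : Measure G) (π : Measure (G × G))
    [IsProbabilityMeasure π] [IsMarkovKernel κ] {d : ℝ} (hd : 0 < d) :
    prependStep hφ ρ π κ d =
      (π ⊗ₘ κ.comap (fun x => d - gap φ x) ((measurable_gap hφ).const_sub d)).map
        fun q => q.1 + q.2 := by
  rw [prependStep, Kernel.piecewise_apply, if_neg (by simpa using hd),
    Kernel.map_apply _ measurable_add, Kernel.compProd_apply_eq_compProd_sectR, Kernel.const_apply]
  rfl

theorem prependStep_real_gapWindow (hφ : Measurable φ) (ρ : Measure G) (π : Measure (G × G))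
    [IsProbabilityMeasure π] [IsMarkovKernel κ] {d : ℝ} (hd : 0 < d) :
    (prependStep hφ ρ π κ d).real (gapWindow φ a d) =
      ∫ x, (κ (d - gap φ x)).real (gapWindow φ a (d - gap φ x)) ∂π := by
  rw [prependStep_of_pos hφ ρ π hd, compProd_map_add_real (measurableSet_gapWindow hφ d)]
  simp only [Kernel.comap_apply, preimage_add_gapWindow]

theorem integrable_real_gapWindow_sub_gap (hφ : Measurable φ) (π : Measure (G × G))
    [IsProbabilityMeasure π] [IsMarkovKernel κ] (a d : ℝ) :
    Integrable (fun x => (κ (d - gap φ x)).real (gapWindow φ a (d - gap φ x))) π := by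
  have meas := measurable_real_add_preimage (measurableSet_gapWindow (a := a) hφ d)
    (η := κ.comap (fun x => d - gap φ x) ((measurable_gap hφ).const_sub d))
  simp only [Kernel.comap_apply, preimage_add_gapWindow] at meas
  exact Integrable.of_mem_Icc 0 1 meas.aemeasurable
    (ae_of_all _ fun x => ⟨measureReal_nonneg, measureReal_le_one⟩)

theorem IsShiftCoupling.exp_neg_mul_mgf_gap_le [IsProbabilityMeasure ν]
    (hκ : IsShiftCoupling φ a θ K ν κ) (hφ : Measurable φ) (ρ : Measure G) {π : Measure (G × G)}
    [IsProbabilityMeasure π] (hgap : ∀ᵐ x ∂π, gap φ x ≤ a) (hθ : 0 ≤ θ) {d : ℝ} (hd : 0 < d) :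
    Real.exp (-(θ * (d + a))) * mgf (gap φ) π θ ≤
      (prependStep hφ ρ π κ d).real (gapWindow φ a d)
        + (1 - (prependStep hφ ρ π κ d).real (gapWindow φ a d)) * K := by
  have := hκ.isMarkovKernel
  set success : G × G → ℝ := fun x => (κ (d - gap φ x)).real (gapWindow φ a (d - gap φ x))
  have hsuccess : Integrable success π := integrable_real_gapWindow_sub_gap hφ π a d
  have hfail : Integrable (fun x => (1 - success x) * K) π :=
    ((integrable_const 1).sub hsuccess).mul_const K
  have hexp : Integrable (fun x => Real.exp (θ * gap φ x)) π :=
    integrable_exp_mul_of_le θ a hθ (measurable_gap hφ).aemeasurable hgap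
  rw [prependStep_real_gapWindow hφ ρ π hd]
  calc Real.exp (-(θ * (d + a))) * mgf (gap φ) π θ
      = ∫ x, Real.exp (-(θ * (d + a))) * Real.exp (θ * gap φ x) ∂π :=
        (integral_const_mul _ _).symm
    _ ≤ ∫ x, (success x + (1 - success x) * K) ∂π := by
        refine integral_mono_ae (hexp.const_mul _) (hsuccess.add hfail) ?_
        filter_upwards [hgap] with x hx
        rw [← Real.exp_add, show -(θ * (d + a)) + θ * gap φ x = -(θ * (d - gap φ x + a)) by ring]
        exact hκ.exp_le _ (by linarith)
    _ = ∫ x, success x ∂π + (1 - ∫ x, success x ∂π) * K := by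
        rw [integral_add hsuccess hfail, integral_mul_const,
          integral_sub (integrable_const 1) hsuccess]
        simp

theorem isShiftCoupling_prependStep [IsProbabilityMeasure μ] [IsProbabilityMeasure ν]
    (hκ : IsShiftCoupling φ a θ K ν κ) (hφ : Measurable φ) {π : Measure (G × G)}
    [IsProbabilityMeasure π] (hfst : π.map Prod.fst = μ) (hsnd : π.map Prod.snd = μ)
    (hgap : ∀ᵐ x ∂π, gap φ x ≤ a) (hθ : 0 ≤ θ) {M : ℝ} (hM1 : 1 ≤ M)
    (hM : M ≤ mgf (gap φ) π θ) :
    IsShiftCoupling φ a θ (K / M) (μ ∗ ν) (prependStep hφ (μ ∗ ν) π κ) := by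
  have := hκ.isMarkovKernel
  refine ⟨fun d => ?_, fun d => ?_, fun d hd => ?_⟩ <;> rcases le_or_gt d 0 with hd0 | hd0
  · rw [prependStep_of_nonpos hφ _ π hd0, diagonalCoupling_map_fst]
  · rw [prependStep_of_pos hφ _ π hd0, ← hfst]
    exact map_compProd_add (f := AddMonoidHom.fst G G) measurable_fst fun x => hκ.map_fst _
  · rw [prependStep_of_nonpos hφ _ π hd0, diagonalCoupling_map_snd]
  · rw [prependStep_of_pos hφ _ π hd0, ← hsnd]
    exact map_compProd_add (f := AddMonoidHom.snd G G) measurable_snd fun x => hκ.map_snd _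
  · rw [prependStep_of_nonpos hφ _ π hd0, diagonalCoupling_real_gapWindow hφ _ hd hd0, sub_self,
      zero_mul, add_zero, Real.exp_le_one_iff, neg_nonpos]
    exact mul_nonneg hθ (by linarith)
  · set p := (prependStep hφ (μ ∗ ν) π κ d).real (gapWindow φ a d)
    have hMpos : 0 < M := by linarith
    have hpM : p ≤ p * M := le_mul_of_one_le_right measureReal_nonneg hM1
    rw [← mul_le_mul_iff_left₀ hMpos]
    calc Real.exp (-(θ * (d + a))) * M
        ≤ Real.exp (-(θ * (d + a))) * mgf (gap φ) π θ := by gcongr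
      _ ≤ p + (1 - p) * K := hκ.exp_neg_mul_mgf_gap_le hφ _ hgap hθ hd0
      _ ≤ p * M + (1 - p) * K := by gcongr
      _ = (p + (1 - p) * (K / M)) * M := by field_simp

end Step

/-- A law for one step of a coupled walk: a coupling of the step law `μ` with itself that is
invariant under swapping the two copies and changes the gap by at most `a`. -/
structure IsSymmStepCoupling (φ : G →+ ℝ) (a : ℝ) (μ : Measure G) (π : Measure (G × G)) :
    Prop where
  map_fst : π.map Prod.fst = μ
  map_swap : π.map Prod.swap = π
  abs_gap_le : ∀ᵐ p ∂π, |gap φ p| ≤ a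

section SymmStep

variable {π : Measure (G × G)}

theorem IsSymmStepCoupling.map_snd (hπ : IsSymmStepCoupling φ a μ π) : π.map Prod.snd = μ := by
  rw [← hπ.map_swap, Measure.map_map measurable_snd measurable_swap]
  exact hπ.map_fst

theorem IsSymmStepCoupling.isProbabilityMeasure [IsProbabilityMeasure μ]
    (hπ : IsSymmStepCoupling φ a μ π) : IsProbabilityMeasure π := by
  have : IsProbabilityMeasure (π.map Prod.fst) := by rwa [hπ.map_fst]
  exact Measure.isProbabilityMeasure_of_map Prod.fst

theorem IsSymmStepCoupling.identDistrib_gap_neg (hπ : IsSymmStepCoupling φ a μ π)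
    (hφ : Measurable φ) : IdentDistrib (gap φ) (-gap φ) π π where
  aemeasurable_fst := (measurable_gap hφ).aemeasurable
  aemeasurable_snd := (measurable_gap hφ).neg.aemeasurable
  map_eq := by
    nth_rw 1 [← hπ.map_swap]
    rw [Measure.map_map (measurable_gap hφ) measurable_swap]
    congr 1
    exact funext gap_swap

theorem IsSymmStepCoupling.one_add_sq_mul_integral_gap_sq_le_mgf [IsProbabilityMeasure μ]
    (hπ : IsSymmStepCoupling φ a μ π) (hφ : Measurable φ) (θ : ℝ) :
    1 + θ ^ 2 / 2 * ∫ x, gap φ x ^ 2 ∂π ≤ mgf (gap φ) π θ := by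
  have := hπ.isProbabilityMeasure
  exact one_add_sq_mul_integral_sq_le_mgf (hπ.identDistrib_gap_neg hφ)
    (integrable_exp_mul_of_mem_Icc (measurable_gap hφ).aemeasurable
      (hπ.abs_gap_le.mono fun _ => abs_le.1))

end SymmStep

section Walk

variable [MeasurableAdd₂ G] {ι Ω Ω' : Type*} [MeasurableSpace Ω] [MeasurableSpace Ω']
  {P : Measure Ω} {Q : Measure Ω'}
  {X : ι → Ω → G} {Y : ι → Ω' → G} {μ : ι → Measure G} {π : ι → Measure (G × G)}

theorem exists_isShiftCoupling_map_sum [IsProbabilityMeasure P] (hφ : Measurable φ)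
    (hX : iIndepFun X P) (hXμ : ∀ i, HasLaw (X i) (μ i) P)
    (hπ : ∀ i, IsSymmStepCoupling φ a (μ i) (π i)) (hθ : 0 ≤ θ) (s : Finset ι) :
    ∃ κ, IsShiftCoupling φ a θ (∏ i ∈ s, (1 + θ ^ 2 / 2 * ∫ x, gap φ x ^ 2 ∂π i))⁻¹
      (P.map (∑ i ∈ s, X i)) κ := by
  classical
  induction s using Finset.induction_on with
  | empty =>
    rw [Finset.prod_empty, inv_one]
    exact ⟨_, isShiftCoupling_const_diagonal φ a hθ _⟩
  | insert i s hi ih =>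
    obtain ⟨κ, hκ⟩ := ih
    have hsum : AEMeasurable (∑ j ∈ s, X j) P :=
      Finset.aemeasurable_sum s fun j _ => (hXμ j).aemeasurable
    have hindep : IndepFun (X i) (∑ j ∈ s, X j) P :=
      (hX.indepFun_finsetSum_of_notMem₀ (fun j => (hXμ j).aemeasurable) hi).symm
    have : IsProbabilityMeasure (P.map (∑ j ∈ s, X j)) := Measure.isProbabilityMeasure_map hsum
    have : IsProbabilityMeasure (μ i) := (hXμ i).isProbabilityMeasure_iff.1 inferInstance
    have := (hπ i).isProbabilityMeasure
    rw [Finset.sum_insert hi, Finset.prod_insert hi, mul_inv, ← div_eq_inv_mul,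
      hindep.map_add_eq_map_conv_map₀ (hXμ i).aemeasurable hsum, (hXμ i).map_eq]
    exact ⟨_, isShiftCoupling_prependStep hκ hφ (hπ i).map_fst (hπ i).map_snd
      ((hπ i).abs_gap_le.mono fun _ h => (le_abs_self _).trans h) hθ
      (le_add_of_nonneg_right (by positivity))
      ((hπ i).one_add_sq_mul_integral_gap_sq_le_mgf hφ θ)⟩

variable [Fintype ι]

theorem map_sum_eq_map_sum_of_hasLaw (hX : iIndepFun X P) (hXμ : ∀ i, HasLaw (X i) (μ i) P)
    (hY : iIndepFun Y Q) (hYμ : ∀ i, HasLaw (Y i) (μ i) Q) :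
    P.map (fun ω => ∑ i, X i ω) = Q.map fun ω => ∑ i, Y i ω :=
  ((IdentDistrib.pi (fun i => (hXμ i).identDistrib (hYμ i)) hX hY).comp
    (u := fun x : ι → G => ∑ i, x i) (by fun_prop)).map_eq

theorem exists_isCouplingOf_sum [IsProbabilityMeasure P] (hφ : Measurable φ) (hX : iIndepFun X P)
    (hXμ : ∀ i, HasLaw (X i) (μ i) P) (hY : iIndepFun Y Q) (hYμ : ∀ i, HasLaw (Y i) (μ i) Q)
    (hπ : ∀ i, IsSymmStepCoupling φ a (μ i) (π i)) (hV : 0 < ∑ i, ∫ x, gap φ x ^ 2 ∂π i)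
    {d : ℝ} (hd : -a ≤ d) :
    ∃ γ, IsCouplingOf γ (fun ω => ∑ i, X i ω) P (fun ω => ∑ i, Y i ω) Q ∧
      1 - 2 * (√(2 / ∑ i, ∫ x, gap φ x ^ 2 ∂π i) * (d + a)) ≤ γ.real (gapWindow φ a d) := by
  set V := ∑ i, ∫ x, gap φ x ^ 2 ∂π i
  set θ := √(2 / V)
  obtain ⟨κ, hκ⟩ := exists_isShiftCoupling_map_sum hφ hX hXμ hπ (Real.sqrt_nonneg (2 / V))
    Finset.univ
  rw [show ∑ i, X i = fun ω => ∑ i, X i ω from funext fun _ => Finset.sum_apply ..] at hκ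
  have hsum : AEMeasurable (fun ω => ∑ i, X i ω) P :=
    Finset.aemeasurable_fun_sum _ fun i _ => (hXμ i).aemeasurable
  have := Measure.isProbabilityMeasure_map hsum
  have := hκ.isMarkovKernel
  have two_le_prod : 2 ≤ ∏ i, (1 + θ ^ 2 / 2 * ∫ x, gap φ x ^ 2 ∂π i) := by
    calc 2 = 1 + θ ^ 2 / 2 * V := by
          rw [Real.sq_sqrt (by positivity)]
          field_simp
          norm_num
      _ = 1 + ∑ i, θ ^ 2 / 2 * ∫ x, gap φ x ^ 2 ∂π i := by rw [Finset.mul_sum]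
      _ ≤ _ := one_add_sum_le_prod_one_add _ fun i _ => by positivity
  refine ⟨κ d, ⟨hκ.map_fst d, ?_⟩, one_sub_two_mul_le_of_exp_neg_le measureReal_le_one ?_
    (hκ.exp_le d hd)⟩
  · rw [hκ.map_snd d, map_sum_eq_map_sum_of_hasLaw hX hXμ hY hYμ]
  · rw [one_div]
    exact inv_anti₀ two_pos two_le_prod

theorem exists_isCouplingOf_sum_of_le_integral_gap_sq [IsProbabilityMeasure P] [Nonempty ι]
    (hφ : Measurable φ) (hX : iIndepFun X P) (hXμ : ∀ i, HasLaw (X i) (μ i) P)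
    (hY : iIndepFun Y Q) (hYμ : ∀ i, HasLaw (Y i) (μ i) Q)
    (hπ : ∀ i, IsSymmStepCoupling φ a (μ i) (π i)) {v A : ℝ} (hv : 0 < v) (hA : 0 < A)
    (hvA : ∀ i, v * A ^ 2 ≤ ∫ x, gap φ x ^ 2 ∂π i) {d : ℝ} (hd : -a ≤ d) :
    ∃ γ, IsCouplingOf γ (fun ω => ∑ i, X i ω) P (fun ω => ∑ i, Y i ω) Q ∧
      1 - 2 * √(2 / v) * (d + a) / (A * √(Fintype.card ι)) ≤ γ.real (gapWindow φ a d) := by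
  have hlow : Fintype.card ι * (v * A ^ 2) ≤ ∑ i, ∫ x, gap φ x ^ 2 ∂π i := by
    simpa using Finset.card_nsmul_le_sum Finset.univ _ _ fun i _ => hvA i
  obtain ⟨γ, hγ, hγd⟩ := exists_isCouplingOf_sum hφ hX hXμ hY hYμ hπ
    (lt_of_lt_of_le (by positivity) hlow) hd
  refine ⟨γ, hγ, le_trans ?_ hγd⟩
  have hda : 0 ≤ d + a := by linarith
  have sqrt_eq : √(2 / (Fintype.card ι * (v * A ^ 2))) = √(2 / v) / (A * √(Fintype.card ι)) := by
    rw [show 2 / (Fintype.card ι * (v * A ^ 2)) = 2 / v / (A ^ 2 * Fintype.card ι) by field_simp,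
      Real.sqrt_div (by positivity), Real.sqrt_mul (by positivity), Real.sqrt_sq hA.le]
  calc 1 - 2 * √(2 / v) * (d + a) / (A * √(Fintype.card ι))
      = 1 - 2 * (√(2 / (Fintype.card ι * (v * A ^ 2))) * (d + a)) := by rw [sqrt_eq]; ring
    _ ≤ _ := by gcongr

end Walk

end Coupling

section MirrorCoupling

variable {G : Type*} [AddCommGroup G] [MeasurableSpace G] [MeasurableNeg G] {φ : G →+ ℝ} {a : ℝ}
  {μ : Measure G}

/-- The coupling of a symmetric law with itself in which each component is the negative of the
other. -/
noncomputable def mirrorCoupling (μ : Measure G) : Measure (G × G) :=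
  μ.map fun x => (x, -x)

theorem isSymmStepCoupling_mirrorCoupling (hφ : Measurable φ) (hμ : μ.map Neg.neg = μ)
    (hμa : ∀ᵐ x ∂μ, |φ x| ≤ a) : IsSymmStepCoupling φ (2 * a) μ (mirrorCoupling μ) where
  map_fst := by
    rw [mirrorCoupling, Measure.map_map measurable_fst (by fun_prop)]
    exact Measure.map_id
  map_swap := by
    nth_rw 1 [mirrorCoupling, ← hμ]
    rw [Measure.map_map (by fun_prop) measurable_neg, Measure.map_map measurable_swap (by fun_prop),
      mirrorCoupling]
    congr 1
    ext x <;> simp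
  abs_gap_le := by
    rw [mirrorCoupling, ae_map_iff (by fun_prop)
      (measurableSet_le (measurable_gap hφ).abs measurable_const)]
    filter_upwards [hμa] with x hx
    rw [gap_apply, map_neg, sub_neg_eq_add, ← two_mul, abs_mul, abs_two]
    linarith

theorem integral_mirrorCoupling_gap_sq (hφ : Measurable φ) :
    ∫ x, gap φ x ^ 2 ∂mirrorCoupling μ = 4 * ∫ x, φ x ^ 2 ∂μ := by
  rw [mirrorCoupling, integral_map (by fun_prop)
    ((measurable_gap hφ).pow_const 2).aestronglyMeasurable, ← integral_const_mul]
  congr 1 with x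
  rw [gap_apply, map_neg]
  ring

end MirrorCoupling

section StaggeredCoupling

variable {G : Type*} [AddCommMonoid G] [MeasurableSpace G] {φ : G →+ ℝ} {a : ℝ}
  {p : ENNReal} {ν : Measure G}

/-- The coupling of the lazy law `ν + p • dirac 0` with itself in which the two components move or
rest independently of each other, and agree when both of them move. -/
noncomputable def staggeredCoupling (p : ENNReal) (ν : Measure G) : Measure (G × G) :=
  p • ν.map (fun x => (x, 0)) + p • ν.map (fun x => (0, x)) + ν Set.univ • diagonalCoupling ν
    + p ^ 2 • Measure.dirac 0

theorem isSymmStepCoupling_staggeredCoupling (hφ : Measurable φ) (hpν : ν Set.univ + p = 1)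
    (ha : 0 ≤ a) (hνa : ∀ᵐ x ∂ν, |φ x| ≤ a) :
    IsSymmStepCoupling φ a (ν + p • Measure.dirac 0) (staggeredCoupling p ν) where
  map_fst := by
    have weight_zero : p * ν Set.univ + p ^ 2 = p := by
      rw [sq, ← mul_add, hpν, mul_one]
    calc (staggeredCoupling p ν).map Prod.fst
        = p • ν + (p * ν Set.univ) • Measure.dirac 0 + ν Set.univ • ν
            + p ^ 2 • Measure.dirac 0 := by
          rw [staggeredCoupling, Measure.map_add _ _ measurable_fst,
            Measure.map_add _ _ measurable_fst, Measure.map_add _ _ measurable_fst]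
          simp only [Measure.map_smul, diagonalCoupling_map_fst, Measure.map_dirac' measurable_fst]
          rw [Measure.map_map measurable_fst (by fun_prop),
            Measure.map_map measurable_fst (by fun_prop), Measure.map_congr (g := id) (by rfl),
            Measure.map_id, Function.comp_def, Measure.map_const, smul_smul, Prod.fst_zero]
      _ = (ν Set.univ + p) • ν + (p * ν Set.univ + p ^ 2) • Measure.dirac 0 := by
          rw [add_smul, add_smul]
          abel
      _ = ν + p • Measure.dirac 0 := by rw [hpν, one_smul, weight_zero]
  map_swap := by
    rw [staggeredCoupling, Measure.map_add _ _ measurable_swap,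
      Measure.map_add _ _ measurable_swap, Measure.map_add _ _ measurable_swap]
    simp only [Measure.map_smul, diagonalCoupling, Measure.map_dirac' measurable_swap,
      Prod.swap_zero]
    rw [Measure.map_map measurable_swap (by fun_prop),
      Measure.map_map measurable_swap (by fun_prop),
      Measure.map_map measurable_swap (by fun_prop), add_comm (p • ν.map _)]
    rfl
  abs_gap_le := by
    have meas : MeasurableSet {x : G × G | |gap φ x| ≤ a} :=
      measurableSet_le (measurable_gap hφ).abs measurable_const
    simp only [staggeredCoupling, diagonalCoupling, ae_add_measure_iff]
    refine ⟨⟨⟨?_, ?_⟩, ?_⟩, ?_⟩ <;> refine Measure.ae_smul_measure ?_ _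
    · rw [ae_map_iff (by fun_prop) meas]
      simpa [gap_apply] using hνa
    · rw [ae_map_iff (by fun_prop) meas]
      simpa [gap_apply] using hνa
    · rw [ae_map_iff (by fun_prop) meas]
      simpa [gap_apply] using ae_of_all _ fun _ => ha
    · rw [ae_dirac_iff meas]
      simpa using ha

theorem integral_staggeredCoupling_gap_sq (hφ : Measurable φ) :
    ∫ x, gap φ x ^ 2 ∂staggeredCoupling p ν = 2 * p.toReal * ∫ x, φ x ^ 2 ∂ν := by
  have meas_gap : Measurable fun x => ENNReal.ofReal (gap φ x ^ 2) :=
    ((measurable_gap hφ).pow_const 2).ennreal_ofReal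
  have lintegral_eq : ∫⁻ x, ENNReal.ofReal (gap φ x ^ 2) ∂staggeredCoupling p ν =
      2 * p * ∫⁻ x, ENNReal.ofReal (φ x ^ 2) ∂ν := by
    simp only [staggeredCoupling, diagonalCoupling, lintegral_add_measure, lintegral_smul_measure,
      lintegral_dirac' _ meas_gap, smul_eq_mul]
    rw [lintegral_map meas_gap (by fun_prop), lintegral_map meas_gap (by fun_prop),
      lintegral_map meas_gap (by fun_prop)]
    simp only [gap_apply, map_zero, sub_zero, zero_sub, even_two, Even.neg_pow, sub_self, ne_eq,
      OfNat.ofNat_ne_zero, not_false_eq_true, zero_pow, ENNReal.ofReal_zero, lintegral_zero,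
      mul_zero, add_zero]
    ring
  rw [integral_eq_lintegral_of_nonneg_ae (ae_of_all _ fun x => sq_nonneg _)
      ((measurable_gap hφ).pow_const 2).aestronglyMeasurable,
    integral_eq_lintegral_of_nonneg_ae (ae_of_all _ fun x => sq_nonneg _)
      (hφ.pow_const 2).aestronglyMeasurable,
    lintegral_eq, ENNReal.toReal_mul, ENNReal.toReal_mul, ENNReal.toReal_ofNat]

end StaggeredCoupling

section LazyStep

variable {r : ℝ} {c : ℤ}

/-- The part of `lazyStepLaw r c` that moves: mass `r` at each of `c` and `-c`. -/
noncomputable def movingStepLaw (r : ℝ) (c : ℤ) : Measure ℤ :=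
  ENNReal.ofReal r • Measure.dirac c + ENNReal.ofReal r • Measure.dirac (-c)

theorem lazyStepLaw_eq_movingStepLaw_add (r : ℝ) (c : ℤ) :
    lazyStepLaw r c = movingStepLaw r c + ENNReal.ofReal (1 - 2 * r) • Measure.dirac 0 := rfl

theorem movingStepLaw_univ_add (hr0 : 0 ≤ r) (hr : r ≤ 1 / 2) :
    movingStepLaw r c Set.univ + ENNReal.ofReal (1 - 2 * r) = 1 := by
  simp only [movingStepLaw, Measure.add_apply, Measure.smul_apply, measure_univ, smul_eq_mul,
    mul_one]
  rw [← ENNReal.ofReal_add hr0 hr0, ← ENNReal.ofReal_add (by linarith) (by linarith),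
    ← ENNReal.ofReal_one]
  congr 1
  ring

theorem ae_movingStepLaw {q : ℤ → Prop} (hc : q c) (hc_neg : q (-c)) :
    ∀ᵐ x ∂movingStepLaw r c, q x := by
  rw [movingStepLaw, ae_add_measure_iff]
  exact ⟨Measure.ae_smul_measure (ae_dirac_eq c ▸ hc) _,
    Measure.ae_smul_measure (ae_dirac_eq (-c) ▸ hc_neg) _⟩

theorem integral_movingStepLaw (hr0 : 0 ≤ r) (f : ℤ → ℝ) :
    ∫ x, f x ∂movingStepLaw r c = r * (f c + f (-c)) := by
  have integrable (b : ℤ) : Integrable f (ENNReal.ofReal r • Measure.dirac b) :=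
    (integrable_dirac (by simp)).smul_measure ENNReal.ofReal_ne_top
  rw [movingStepLaw, integral_add_measure (integrable _) (integrable _), integral_smul_measure,
    integral_smul_measure, integral_dirac, integral_dirac, ENNReal.toReal_ofReal hr0, smul_eq_mul,
    smul_eq_mul, mul_add]

theorem lazyStepLaw_half (c : ℤ) : lazyStepLaw (1 / 2) c = movingStepLaw (1 / 2) c := by
  simp [lazyStepLaw_eq_movingStepLaw_add]

theorem map_neg_movingStepLaw : (movingStepLaw r c).map Neg.neg = movingStepLaw r c := by
  rw [movingStepLaw, Measure.map_add _ _ measurable_neg, Measure.map_smul, Measure.map_smul,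
    Measure.map_dirac' measurable_neg, Measure.map_dirac' measurable_neg, neg_neg, add_comm]

variable {ι Ω Ω' : Type*} [Fintype ι] [Nonempty ι] [MeasurableSpace Ω] [MeasurableSpace Ω']
  {P : Measure Ω} [IsProbabilityMeasure P] {Q : Measure Ω'} {X : ι → Ω → ℤ} {Y : ι → Ω' → ℤ}
  {k : ι → ℤ} {A B d : ℝ}

theorem exists_isCouplingOf_sum_lazyStepLaw (hr0 : 0 < r) (hr : r < 1 / 2) (hX : iIndepFun X P)
    (hXk : ∀ i, HasLaw (X i) (lazyStepLaw r (k i)) P) (hY : iIndepFun Y Q)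
    (hYk : ∀ i, HasLaw (Y i) (lazyStepLaw r (k i)) Q) (hA : 0 < A)
    (hAk : ∀ i, A ≤ |(k i : ℝ)|) (hkB : ∀ i, |(k i : ℝ)| ≤ B) (hd : -B ≤ d) :
    ∃ γ, IsCouplingOf γ (fun ω => ∑ i, X i ω) P (fun ω => ∑ i, Y i ω) Q ∧
      1 - 2 * √(2 / (4 * r * (1 - 2 * r))) * (d + B) / (A * √(Fintype.card ι)) ≤
        γ.real (gapWindow (Int.castAddHom ℝ) B d) := by
  have hφ : Measurable (Int.castAddHom ℝ) := .of_discrete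
  have hlazy : 0 < 1 - 2 * r := by linarith
  have hB : 0 ≤ B := (abs_nonneg _).trans (hkB (Classical.arbitrary ι))
  refine exists_isCouplingOf_sum_of_le_integral_gap_sq hφ hX hXk hY hYk
    (π := fun i => staggeredCoupling (ENNReal.ofReal (1 - 2 * r)) (movingStepLaw r (k i)))
    (fun i => isSymmStepCoupling_staggeredCoupling hφ (movingStepLaw_univ_add hr0.le hr.le) hB
      (ae_movingStepLaw (hkB i) (by simpa using hkB i))) (by positivity) hA (fun i => ?_) hd
  have sq_le : A ^ 2 ≤ (k i : ℝ) ^ 2 := sq_le_sq.2 ((abs_of_pos hA).trans_le (hAk i))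
  rw [integral_staggeredCoupling_gap_sq hφ, ENNReal.toReal_ofReal hlazy.le,
    integral_movingStepLaw hr0.le]
  calc 4 * r * (1 - 2 * r) * A ^ 2 ≤ 4 * r * (1 - 2 * r) * (k i : ℝ) ^ 2 := by gcongr
    _ = _ := by
      simp only [Int.coe_castAddHom, Int.cast_neg]
      ring

theorem exists_isCouplingOf_sum_lazyStepLaw_half (hX : iIndepFun X P)
    (hXk : ∀ i, HasLaw (X i) (lazyStepLaw (1 / 2) (k i)) P) (hY : iIndepFun Y Q)
    (hYk : ∀ i, HasLaw (Y i) (lazyStepLaw (1 / 2) (k i)) Q) (hA : 0 < A)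
    (hAk : ∀ i, A ≤ |(k i : ℝ)|) (hkB : ∀ i, |(k i : ℝ)| ≤ B) (hd : -(2 * B) ≤ d) :
    ∃ γ, IsCouplingOf γ (fun ω => ∑ i, X i ω) P (fun ω => ∑ i, Y i ω) Q ∧
      1 - 2 * √(2 / 4) * (d + 2 * B) / (A * √(Fintype.card ι)) ≤
        γ.real (gapWindow (Int.castAddHom ℝ) (2 * B) d) := by
  have hφ : Measurable (Int.castAddHom ℝ) := .of_discrete
  simp only [lazyStepLaw_half] at hXk hYk
  refine exists_isCouplingOf_sum_of_le_integral_gap_sq hφ hX hXk hY hYk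
    (π := fun i => mirrorCoupling (movingStepLaw (1 / 2) (k i)))
    (fun i => isSymmStepCoupling_mirrorCoupling hφ map_neg_movingStepLaw
      (ae_movingStepLaw (hkB i) (by simpa using hkB i))) four_pos hA (fun i => ?_) hd
  have sq_le : A ^ 2 ≤ (k i : ℝ) ^ 2 := sq_le_sq.2 ((abs_of_pos hA).trans_le (hAk i))
  rw [integral_mirrorCoupling_gap_sq hφ, integral_movingStepLaw (by norm_num)]
  calc 4 * A ^ 2 ≤ 4 * (k i : ℝ) ^ 2 := by gcongr
    _ = _ := by
      simp only [Int.coe_castAddHom, Int.cast_neg]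
      ring

end LazyStep

theorem mainTheorem7 (r : ℝ) (hr0 : 0 < r) (hr : r ≤ 1 / 2) :
    ∃ δ : ℝ, 0 < δ ∧
      ∀ (A : ℝ), 0 < A →
      ∀ (m : ℕ), 1 ≤ m →
      ∀ (c : Fin m → ℕ), (∀ i, A ≤ (c i : ℝ) ∧ (c i : ℝ) ≤ 2 * A) →
      ∀ {Ω Ω' : Type*} [MeasurableSpace Ω] [MeasurableSpace Ω']
        (P : Measure Ω) [IsProbabilityMeasure P] (Q : Measure Ω') [IsProbabilityMeasure Q]
        (X : Fin m → Ω → ℤ) (Y : Fin m → Ω' → ℤ),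
        iIndepFun X P → (∀ i, HasLaw (X i) (lazyStepLaw r (c i)) P) →
        iIndepFun Y Q → (∀ i, HasLaw (Y i) (lazyStepLaw r (c i)) Q) →
      ∀ (d : ℝ), 0 < d →
        ∃ γ : Measure (ℤ × ℤ),
          IsCouplingOf γ (fun ω => ∑ i, X i ω) P (fun ω => ∑ i, Y i ω) Q ∧
          (r < 1 / 2 →
            1 - δ * (d + A) / (A * √(m : ℝ)) ≤
              γ.real {p : ℤ × ℤ | d ≤ (p.1 : ℝ) - (p.2 : ℝ) ∧
                (p.1 : ℝ) - (p.2 : ℝ) ≤ d + 2 * A}) ∧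
          (r = 1 / 2 →
            1 - δ * (d + A) / (A * √(m : ℝ)) ≤
              γ.real {p : ℤ × ℤ | d ≤ (p.1 : ℝ) - (p.2 : ℝ) ∧
                (p.1 : ℝ) - (p.2 : ℝ) ≤ d + 4 * A}) := by
  rcases hr.lt_or_eq with hlazy | rfl
  · have hrest : 0 < 1 - 2 * r := by linarith
    refine ⟨4 * (2 * √(2 / (4 * r * (1 - 2 * r)))), by positivity, ?_⟩
    intro A hA m hm c hc Ω Ω' _ _ P _ Q _ X Y hX hXc hY hYc d hd
    have : NeZero m := ⟨by omega⟩
    obtain ⟨γ, hγ, hγd⟩ := exists_isCouplingOf_sum_lazyStepLaw hr0 hlazy hX hXc hY hYc hA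
      (B := 2 * A) (d := d) (by simpa using fun i => (hc i).1) (by simpa using fun i => (hc i).2)
      (by linarith)
    rw [Fintype.card_fin] at hγd
    refine ⟨γ, hγ, fun _ => le_trans ?_ hγd, fun h => absurd h hlazy.ne⟩
    exact one_sub_four_mul_div_le (by positivity) (by positivity) hd.le (by linarith)
  · refine ⟨4 * (2 * √(2 / 4)), by positivity, ?_⟩
    intro A hA m hm c hc Ω Ω' _ _ P _ Q _ X Y hX hXc hY hYc d hd
    have : NeZero m := ⟨by omega⟩
    obtain ⟨γ, hγ, hγd⟩ := exists_isCouplingOf_sum_lazyStepLaw_half hX hXc hY hYc hA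
      (B := 2 * A) (d := d) (by simpa using fun i => (hc i).1) (by simpa using fun i => (hc i).2)
      (by linarith)
    rw [Fintype.card_fin, show 2 * (2 * A) = 4 * A by ring] at hγd
    refine ⟨γ, hγ, fun h => absurd h (lt_irrefl _), fun _ => le_trans ?_ hγd⟩
    exact one_sub_four_mul_div_le (by positivity) (by positivity) hd.le le_rfl
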